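/- \textbf{Online problems.} An online minimization problem $\mathsf P$ has a set of initial states, a set of requests and a set of answers. An input is $\sigma=(s,x_1,\dots,x_n)$, where $s$ is an initial state and $x_1,\dots,x_n$ are $n=|\sigma|\ge 0$ requests; an output is a sequence $(y_1,\dots,y_n)$ of valid answers, where the non-empty set of values that are valid for $y_i$ may depend on $s,x_1,\dots,x_i,y_1,\dots,y_{i-1}$. Every output has a cost in $[0,\infty]$, and $\mathrm{OPT}(\sigma)$ is the infimum of the costs of the outputs for $\sigma$. A deterministic online algorithm (without advice) computes each $y_i$ from $s,x_1,\dots,x_i$. A randomized online algorithm (without advice) is a probability distribution over such deterministic algorithms. A deterministic online algorithm with advice computes each $y_i$ from $s,x_1,\dots,x_i$ and an infinite binary tape, prepared by an oracle that knows $\sigma$ and read by the algorithm from left to right; its advice complexity $b(n)$ is the largest number of bits that it reads over all inputs of length at most $n$. An algorithm with (expected) cost $C(\sigma)$ is $c$-competitive if there is a constant $\alpha$ such that $C(\sigma)\le c\cdot\mathrm{OPT}(\sigma)+\alpha$ for all inputs $\sigma$. \textbf{Lazy task systems.} A finite lazy task system consists of a finite set $S$ of states, a finite set $T$ of tasks $t:S\to[0,\infty]$,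 each of which is finite at some state, and a function $d:S\times S\to[0,\infty)$ such that $d(s,s')>0$ whenever $s\ne s'$, and $d(s,s')\le d(s,s'')+d(s'',s')$ for all $s,s',s''$. It is the online minimization problem with inputs $(s_0,t_1,\dots,t_n)$, $s_0\in S$, $t_i\in T$, in which the answer to $t_i$ is a state $s_i$ with $t_i(s_i)\neq\infty$ and the cost of $(s_1,\dots,s_n)$ is $\sum_{i=1}^n\bigl(d(s_{i-1},s_i)+t_i(s_i)\bigr)$. The problem $\mathsf P$ can be modeled as this system if its initial states can be mapped to states and its requests to tasks in such a way that, on every input, outputs of $\mathsf P$ can be translated online (the $i$-th answer from the initial state, the first $i$ requests and the first $i$ answers) to outputs of the system on the corresponding input, and vice versa, in both directions without increasing the cost. \textbf{Theorem.} Let $\mathsf P$ be an online minimization problem which can be modeled as a finite lazy task system, let $c\ge 1$ be a constant, and suppose that $\mathsf P$ has a deterministic $c$-competitive online algorithm with advice whose advice complexity is finite and satisfies $b(n)=o(n)$. Then for every $\varepsilon>0$ there exists a randomized $(c+\varepsilon)$-competitive online algorithm for $\mathsf P$ without advice. -/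

import Mathlib

open MeasureTheory Filter Asymptotics
open scoped NNReal ENNReal

universe u v w u' v' w'

/-! ### Online minimization problems -/

/-- `ys = (y₁, …, yₙ)` is a valid sequence of answers to the requests `xs = (x₁, …, xₙ)`:
each `yᵢ` lies in the set `valid (x₁, …, xᵢ₋₁) (y₁, …, yᵢ₋₁) xᵢ`. -/
def IsValidSeq {X : Type v} {Y : Type w} (valid : List X → List Y → X → Set Y)
    (xs : List X) (ys : List Y) : Prop :=
  ys.length = xs.length ∧ ∀ (i : ℕ) (hx : i < xs.length) (hy : i < ys.length),
    ys[i] ∈ valid (xs.take i) (ys.take i) xs[i]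

/-- An online minimization problem. An input is an initial state `s : Init` together with a finite
sequence of requests; each request has to be answered on arrival by a valid answer, where the
non-empty set of valid answers may depend on the initial state, the past requests, the past answers
and the current request. Every output has a non-negative cost. -/
structure OnlineProblem where
  Init : Type u
  Req : Type v
  Ans : Type w
  valid : Init → List Req → List Ans → Req → Set Ans
  cost : Init → List Req → List Ans → ℝ≥0∞
  valid_nonempty : ∀ s xs ys, IsValidSeq (valid s) xs ys → ∀ x, (valid s xs ys x).Nonempty

namespace OnlineProblem

/-- `ys` is a valid output for the input `(s, xs)`. -/
def IsOutput (P : OnlineProblem.{u, v, w}) (s : P.Init) (xs : List P.Req) (ys : List P.Ans) :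
    Prop :=
  IsValidSeq (P.valid s) xs ys

/-- The optimal offline cost of the input `(s, xs)`. -/
noncomputable def opt (P : OnlineProblem.{u, v, w}) (s : P.Init) (xs : List P.Req) : ℝ≥0∞ :=
  ⨅ (ys : List P.Ans) (_ : P.IsOutput s xs ys), P.cost s xs ys

/-- The sequence of answers to `xs = (x₁, …, xₙ)` given by a rule `f` which computes the `i`-th
answer from `(x₁, …, xᵢ₋₁)` and `xᵢ`. -/
def answers {X : Type v} {Y : Type w} (f : List X → X → Y) (xs : List X) : List Y :=
  List.ofFn fun i : Fin xs.length => f (xs.take i.val) xs[i.val]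

/-- A cost function `C` on inputs is `c`-competitive if, up to an additive constant that does not
depend on the input, it is at most `c` times the optimal cost. -/
def IsCompetitive (P : OnlineProblem.{u, v, w}) (c : ℝ≥0) (C : P.Init → List P.Req → ℝ≥0∞) :
    Prop :=
  ∃ α : ℝ≥0, ∀ (s : P.Init) (xs : List P.Req), C s xs ≤ c * P.opt s xs + α

end OnlineProblem

/-! ### Algorithms -/

/-- A deterministic online algorithm (without advice). -/
structure DetAlg (P : OnlineProblem.{u, v, w}) where
  /-- The answer to the current request, given the initial state and the past requests. -/
  answer : P.Init → List P.Req → P.Req → P.Ans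
  isOutput : ∀ s xs, P.IsOutput s xs (OnlineProblem.answers (answer s) xs)

namespace DetAlg

def output {P : OnlineProblem.{u, v, w}} (A : DetAlg P) (s : P.Init) (xs : List P.Req) :
    List P.Ans :=
  OnlineProblem.answers (A.answer s) xs

def cost {P : OnlineProblem.{u, v, w}} (A : DetAlg P) (s : P.Init) (xs : List P.Req) : ℝ≥0∞ :=
  P.cost s xs (A.output s xs)

end DetAlg

/-- A randomized online algorithm (without advice): a probability distribution over deterministic
online algorithms, such that the output and the cost on each fixed input are observable. -/
structure RandAlg (P : OnlineProblem.{u, v, w}) where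
  events : MeasurableSpace (DetAlg P)
  law : @Measure (DetAlg P) events
  isProbabilityMeasure : @IsProbabilityMeasure (DetAlg P) events law
  measurableSet_output : ∀ s xs ys, MeasurableSet[events] {A : DetAlg P | A.output s xs = ys}
  measurable_cost : ∀ s xs, Measurable[events] fun A : DetAlg P => A.cost s xs

/-- The expected cost of a randomized online algorithm on the input `(s, xs)`. -/
noncomputable def RandAlg.expectedCost {P : OnlineProblem.{u, v, w}} (R : RandAlg P)
    (s : P.Init) (xs : List P.Req) : ℝ≥0∞ :=
  @lintegral (DetAlg P) R.events R.law fun A => A.cost s xs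

/-- The content of an infinite advice tape. -/
abbrev Tape : Type := ℕ → Bool

/-- A deterministic online algorithm with advice, in the advice-on-tape model. The tape is read
from left to right, and the algorithm decides itself how many bits it reads. -/
structure AdviceAlg (P : OnlineProblem.{u, v, w}) where
  /-- The answer to the current request, given the tape, the initial state and the past requests. -/
  answer : Tape → P.Init → List P.Req → P.Req → P.Ans
  /-- The total number of bits of the tape read up to and including the answer to the last of the
  given requests. -/
  bitsRead : Tape → P.Init → List P.Req → ℕ
  bitsRead_mono : ∀ φ s xs x, bitsRead φ s xs ≤ bitsRead φ s (xs ++ [x])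
  /-- What the algorithm does depends only on the part of the tape that it has read. -/
  bitsRead_congr : ∀ φ φ' s xs, (∀ i < bitsRead φ s xs, φ i = φ' i) →
    bitsRead φ s xs = bitsRead φ' s xs
  answer_congr : ∀ φ φ' s xs x, (∀ i < bitsRead φ s (xs ++ [x]), φ i = φ' i) →
    answer φ s xs x = answer φ' s xs x
  /-- The tape that the oracle prepares for a given input. -/
  advice : P.Init → List P.Req → Tape
  isOutput : ∀ s xs, P.IsOutput s xs (OnlineProblem.answers (answer (advice s xs) s) xs)

namespace AdviceAlg

def output {P : OnlineProblem.{u, v, w}} (A : AdviceAlg P) (s : P.Init) (xs : List P.Req) :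
    List P.Ans :=
  OnlineProblem.answers (A.answer (A.advice s xs) s) xs

def cost {P : OnlineProblem.{u, v, w}} (A : AdviceAlg P) (s : P.Init) (xs : List P.Req) : ℝ≥0∞ :=
  P.cost s xs (A.output s xs)

/-- The largest number of advice bits read over all inputs of length at most `n`. -/
noncomputable def adviceComplexity {P : OnlineProblem.{u, v, w}} (A : AdviceAlg P) (n : ℕ) : ℕ∞ :=
  ⨆ (s : P.Init) (xs : List P.Req) (_ : xs.length ≤ n), (A.bitsRead (A.advice s xs) s xs : ℕ∞)

/-- The advice complexity is finite and of order `o(n)`. -/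
def HasSublinearAdvice {P : OnlineProblem.{u, v, w}} (A : AdviceAlg P) : Prop :=
  ∃ b : ℕ → ℕ, (∀ n, A.adviceComplexity n = b n) ∧
    (fun n => (b n : ℝ)) =o[atTop] fun n => (n : ℝ)

end AdviceAlg

/-! ### Modeling one online problem as another -/

/-- The sequence whose `i`-th member is computed by `f` from the first `i` requests and the first
`i` answers. -/
def onlineTranslate {X : Type v} {Y : Type w} {Z : Type w'} (f : List X → List Y → Z)
    (xs : List X) (ys : List Y) : List Z :=
  List.ofFn fun i : Fin xs.length => f (xs.take (i.val + 1)) (ys.take (i.val + 1))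

/-- A modeling of the online problem `P` as the online problem `Q`: initial states and requests of
`P` are translated to initial states and requests of `Q`, and outputs can be translated online, in
both directions, without an increase of the cost. -/
structure OnlineProblem.Modeling (P : OnlineProblem.{u, v, w})
    (Q : OnlineProblem.{u', v', w'}) where
  init : P.Init → Q.Init
  req : P.Req → Q.Req
  /-- The current answer in `Q`, from the requests and answers in `P` so far. -/
  enc : P.Init → List P.Req → List P.Ans → Q.Ans
  /-- The current answer in `P`, from the requests so far and the answers in `Q` so far. -/
  dec : P.Init → List P.Req → List Q.Ans → P.Ans
  isOutput_enc : ∀ s xs ys, P.IsOutput s xs ys →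
    Q.IsOutput (init s) (xs.map req) (onlineTranslate (enc s) xs ys)
  cost_enc_le : ∀ s xs ys, P.IsOutput s xs ys →
    Q.cost (init s) (xs.map req) (onlineTranslate (enc s) xs ys) ≤ P.cost s xs ys
  isOutput_dec : ∀ s xs zs, Q.IsOutput (init s) (xs.map req) zs →
    P.IsOutput s xs (onlineTranslate (dec s) xs zs)
  cost_dec_le : ∀ s xs zs, Q.IsOutput (init s) (xs.map req) zs →
    P.cost s xs (onlineTranslate (dec s) xs zs) ≤ Q.cost (init s) (xs.map req) zs

/-! ### Task systems -/

/-- A generalized task system: states, a set of allowable tasks and an arbitrary non-negative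
distance function. A task gives every state a processing cost, not all of them infinite. -/
structure GenTaskSystem where
  State : Type u
  tasks : Set (State → ℝ≥0∞)
  d : State → State → ℝ≥0
  exists_ne_top : ∀ t ∈ tasks, ∃ s, t s ≠ ∞

namespace GenTaskSystem

/-- The total cost of starting in `s₀` and serving the tasks `t₁, …, tₙ` in the states
`s₁, …, sₙ`, namely `∑ᵢ (d sᵢ₋₁ sᵢ + tᵢ sᵢ)`. -/
noncomputable def totalCost (G : GenTaskSystem.{u}) :
    G.State → List (G.State → ℝ≥0∞) → List G.State → ℝ≥0∞
  | s₀, t :: ts, s :: ss => (G.d s₀ s + t s) + G.totalCost s ts ss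
  | _, _, _ => 0

/-- The online minimization problem defined by a generalized task system. -/
noncomputable def toProblem (G : GenTaskSystem.{u}) : OnlineProblem.{u, u, u} where
  Init := G.State
  Req := G.tasks
  Ans := G.State
  valid _ _ _ t := {s | t.val s ≠ ∞}
  cost s₀ ts ss := G.totalCost s₀ (ts.map Subtype.val) ss
  valid_nonempty _ _ _ _ t := G.exists_ne_top t.val t.property

/-- A lazy task system: distinct states have positive distance and the triangle inequality holds.
Neither symmetry nor `d s s = 0` is required. -/
structure IsLazy (G : GenTaskSystem.{u}) : Prop where
  d_pos : ∀ s s' : G.State, s ≠ s' → 0 < G.d s s'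
  d_triangle : ∀ s s' s'' : G.State, G.d s s' ≤ G.d s s'' + G.d s'' s'

/-- Both the set of states and the set of tasks are finite. -/
def IsFinite (G : GenTaskSystem.{u}) : Prop :=
  Finite G.State ∧ G.tasks.Finite

end GenTaskSystem

/-- The online problem `P` can be modeled as a finite lazy task system. -/
def OnlineProblem.CanBeModeledAsFiniteLTS (P : OnlineProblem.{u, v, w}) : Prop :=
  ∃ G : GenTaskSystem.{u'}, G.IsLazy ∧ G.IsFinite ∧ Nonempty (P.Modeling G.toProblem)

/-! The proof combines minimax with a union bound over advice strings. Deterministic strategies for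
the task system form a product of finite discrete spaces, hence a compact space on which the excess
cost − c·OPT of each fixed input is continuous. Let D bound the distances. By
`exists_probabilityMeasure_integral_le`, either some random strategy has expected excess at most D +
cD + 1 on every input, or finitely many inputs carry a distribution under which every deterministic
strategy has mean excess at least D + cD + 1.

In the second case, concatenate r inputs drawn from this distribution. By the triangle inequality
each junction changes the cost and the optimum by at most D, so every block still contributes mean
excess at least 1, whatever came before. An exponential moment bound makes it exponentially unlikely
in r that a fixed strategy keeps its excess below a small multiple of r. Advice of b bits amounts to
only 2^b strategies, and b = o(n), so some concatenation defeats all of them at once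
(`exists_hard_concatenation`, `exists_strategy_of_small_families`), against the competitiveness of
the advice algorithm.

The modeling carries the advice algorithm into the task system and the random strategy back. -/

section Minimax

/-! ### Minimax on a compact space -/

variable {Ω : Type*} [TopologicalSpace Ω] [MeasurableSpace Ω] [BorelSpace Ω] [CompactSpace Ω]

theorem integrable_continuousMap (f : C(Ω, ℝ)) (μ : Measure Ω) [IsFiniteMeasure μ] :
    Integrable f μ :=
  (BoundedContinuousFunction.mkOfCompact f).integrable μ

/-- The vectors of expected values of finitely many continuous functions form a convex set. -/
theorem convex_setOf_integral {J : Type*} (v : J → C(Ω, ℝ)) :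
    Convex ℝ {y : J → ℝ | ∃ μ : ProbabilityMeasure Ω, ∀ j, y j = ∫ ω, v j ω ∂(μ : Measure Ω)} := by
  rintro y ⟨μ, hμ⟩ z ⟨ν, hν⟩ a b ha hb hab
  refine ⟨⟨ENNReal.ofReal a • (μ : Measure Ω) + ENNReal.ofReal b • (ν : Measure Ω), ⟨?_⟩⟩, ?_⟩
  · simp [← ENNReal.ofReal_add ha hb, hab]
  · intro j
    have h1 := (integrable_continuousMap (v j) (μ : Measure Ω)).smul_measure
      (c := ENNReal.ofReal a) ENNReal.ofReal_ne_top
    have h2 := (integrable_continuousMap (v j) (ν : Measure Ω)).smul_measure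
      (c := ENNReal.ofReal b) ENNReal.ofReal_ne_top
    simp only [ProbabilityMeasure.coe_mk]
    rw [integral_add_measure h1 h2, integral_smul_measure, integral_smul_measure,
      ENNReal.toReal_ofReal ha, ENNReal.toReal_ofReal hb, ← hμ, ← hν]
    rfl

/-- A minimax principle for finitely many continuous functions. -/
theorem exists_probabilityMeasure_integral_lt [Nonempty Ω] {J : Type*} [Fintype J]
    (v : J → C(Ω, ℝ)) (a : ℝ)
    (h : ∀ p : J → ℝ, (∀ j, 0 ≤ p j) → ∑ j, p j = 1 → ∃ ω, ∑ j, p j * v j ω < a) :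
    ∃ μ : ProbabilityMeasure Ω, ∀ j, ∫ ω, v j ω ∂(μ : Measure Ω) < a := by
  classical
  by_contra hcon
  push Not at hcon
  -- Separate the open orthant below `a` from the convex set of expectation vectors; the
  -- coefficients of the separating functional become the weights.
  obtain ⟨f, u, hs, ht⟩ := geometric_hahn_banach_open
    (s := Set.pi Set.univ fun _ : J => Set.Iio a)
    (convex_pi fun j _ => convex_Iio a) (isOpen_set_pi Set.finite_univ fun _ _ => isOpen_Iio)
    (convex_setOf_integral v) (by
      rw [Set.disjoint_left]
      rintro y hy ⟨μ, hμ⟩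
      obtain ⟨j, hj⟩ := hcon μ
      have := hy j trivial
      rw [Set.mem_Iio, hμ] at this
      exact absurd this (not_lt.2 hj))
  have hf : ∀ y, f y = ∑ j, f (Pi.single j 1) * y j := by
    intro y
    conv_lhs => rw [pi_eq_sum_univ' y, map_sum]
    refine Finset.sum_congr rfl fun j _ => ?_
    rw [map_smul, smul_eq_mul, mul_comm]
  set p : J → ℝ := fun j => f (Pi.single j 1) with hp
  have hdirac : ∀ ω, u ≤ f fun j => v j ω := by
    intro ω
    refine ht _ ⟨⟨Measure.dirac ω, inferInstance⟩, fun j => ?_⟩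
    exact (integral_dirac' _ _ (v j).continuous.stronglyMeasurable).symm
  have hp0 : ∀ j, 0 ≤ p j := by
    intro j
    by_contra! hneg
    set y0 : J → ℝ := fun _ => a - 1 with hy0
    -- Lowering coordinate `j` by `M` raises `f` by exactly `|u - f y0|`, hence to at least `u`,
    -- without leaving the orthant.
    set M : ℝ := |u - f y0| / (-p j) with hM
    have hM0 : 0 ≤ M := div_nonneg (abs_nonneg _) (by linarith)
    have := hs (y0 - M • Pi.single j 1) (by
      intro i _
      by_cases hij : i = j
      · subst hij
        simp [y0]; linarith
      · simp [y0, hij])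
    rw [map_sub, map_smul, smul_eq_mul] at this
    have h2 : M * p j = - |u - f y0| := by
      rw [hM, div_neg, neg_mul, div_mul_cancel₀ _ hneg.ne]
    change f y0 - M * p j < u at this
    rw [h2] at this
    linarith [le_abs_self (u - f y0)]
  have hsum : ∀ a' < a, a' * ∑ j, p j < u := by
    intro a' ha'
    have := hs (fun _ => a') fun _ _ => ha'
    rw [hf] at this
    rwa [← Finset.sum_mul, mul_comm] at this
  obtain ⟨ω₀⟩ := ‹Nonempty Ω›
  -- If all weights vanished, `f` would be zero, and the two sides of the separation would give `u ≤
  -- 0 < u`.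
  have hP : 0 < ∑ j, p j := by
    refine (Finset.sum_nonneg fun j _ => hp0 j).lt_of_ne' fun h0 => ?_
    have hz := (Finset.sum_eq_zero_iff_of_nonneg fun j _ => hp0 j).1 h0
    have h1 := hdirac ω₀
    rw [hf, Finset.sum_eq_zero fun j hj => by
      rw [show f (Pi.single j 1) = 0 from hz j hj, zero_mul]] at h1
    have h2 := hsum (a - 1) (by linarith)
    rw [h0, mul_zero] at h2
    linarith
  obtain ⟨ω, hω⟩ := h (fun j => p j / ∑ i, p i) (fun j => div_nonneg (hp0 j) hP.le)
    (by rw [← Finset.sum_div, div_self hP.ne'])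
  have h1 := hdirac ω
  rw [hf] at h1
  have h2 : (∑ j, p j / (∑ i, p i) * v j ω) * ∑ i, p i < a * ∑ i, p i :=
    mul_lt_mul_of_pos_right hω hP
  have h3 : (∑ j, p j / (∑ i, p i) * v j ω) * ∑ i, p i = ∑ j, p j * v j ω := by
    rw [Finset.sum_mul]
    exact Finset.sum_congr rfl fun j _ => by field_simp
  have h4 := hsum ((∑ j, p j * v j ω) / ∑ i, p i) (by rw [← h3]; field_simp at *; exact h2)
  rw [div_mul_cancel₀ _ hP.ne'] at h4
  exact absurd h1 (not_le.2 h4)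

/-- A minimax principle for infinitely many continuous functions on a compact space. -/
theorem exists_probabilityMeasure_integral_le [T2Space Ω] [Nonempty Ω] {J : Type*}
    (v : J → C(Ω, ℝ)) (a : ℝ)
    (h : ∀ (F : Finset J) (p : F → ℝ), (∀ j, 0 ≤ p j) → ∑ j, p j = 1 →
      ∃ ω, ∑ j, p j * v j ω < a) :
    ∃ μ : ProbabilityMeasure Ω, ∀ j, ∫ ω, v j ω ∂(μ : Measure Ω) ≤ a := by
  -- Each constraint is closed in the compact space of probability measures, so finite families of
  -- constraints suffice.
  obtain ⟨μ, -, hμ⟩ := (isCompact_univ (X := ProbabilityMeasure Ω)).inter_iInter_nonempty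
    (fun j => {μ | ∫ ω, v j ω ∂(μ : Measure Ω) ≤ a})
    (fun j => isClosed_le (ProbabilityMeasure.continuous_integral_continuousMap (v j))
      continuous_const) (by
      intro F
      obtain ⟨μ, hμ⟩ := exists_probabilityMeasure_integral_lt (fun j : F => v j) a (h F)
      exact ⟨μ, trivial, Set.mem_iInter₂.2 fun j hj => (hμ ⟨j, hj⟩).le⟩)
  exact ⟨μ, fun j => Set.mem_iInter.1 hμ j⟩

end Minimax

/-! ### Answer sequences produced by a rule -/

namespace OnlineProblem

variable {X : Type v} {Y : Type w}

@[simp] theorem length_answers (f : List X → X → Y) (xs : List X) :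
    (answers f xs).length = xs.length := by
  simp [answers]

@[simp] theorem answers_nil (f : List X → X → Y) : answers f [] = [] := rfl

@[simp] theorem answers_cons (f : List X → X → Y) (x : X) (xs : List X) :
    answers f (x :: xs) = f [] x :: answers (fun l => f (x :: l)) xs := by
  simp [answers, List.ofFn_succ]

theorem answers_append (f : List X → X → Y) (xs xs' : List X) :
    answers f (xs ++ xs') = answers f xs ++ answers (fun l => f (xs ++ l)) xs' := by
  induction xs generalizing f with
  | nil => simp
  | cons x xs ih => simp [ih]

end OnlineProblem

/-! ### Costs and optima of concatenated inputs -/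

namespace GenTaskSystem

variable {G : GenTaskSystem.{u}}

theorem isOutput_iff_forall₂ {s : G.State} {ts : List G.tasks} {zs : List G.State} :
    G.toProblem.IsOutput s ts zs ↔ List.Forall₂ (fun t z => t.val z ≠ ∞) ts zs := by
  rw [List.forall₂_iff_get]
  constructor
  · rintro ⟨h, h'⟩
    exact ⟨h.symm, fun i h₁ h₂ => h' i h₁ h₂⟩
  · rintro ⟨h, h'⟩
    exact ⟨h.symm, fun i h₁ h₂ => h' i h₁ h₂⟩

theorem totalCost_ne_top {s : G.State} {ts : List G.tasks} {zs : List G.State}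
    (h : List.Forall₂ (fun t z => t.val z ≠ ∞) ts zs) :
    G.totalCost s (ts.map Subtype.val) zs ≠ ∞ := by
  induction h generalizing s with
  | nil => simp [totalCost]
  | cons h _ ih =>
    rw [List.map_cons, totalCost]
    exact ENNReal.add_ne_top.2 ⟨ENNReal.add_ne_top.2 ⟨ENNReal.coe_ne_top, h⟩, ih⟩

/-- Distances are finite and every task is finite somewhere, so some output has finite cost. This
allows real-valued optima later. -/
theorem opt_ne_top (s : G.State) (ts : List G.tasks) : G.toProblem.opt s ts ≠ ∞ := by
  choose f hf using G.exists_ne_top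
  have h : List.Forall₂ (fun t z => t.val z ≠ ∞) ts (ts.map fun t : G.tasks => f t t.2) := by
    rw [List.forall₂_map_right_iff, List.forall₂_same]
    exact fun t _ => hf t t.2
  exact ne_top_of_le_ne_top (totalCost_ne_top h) (iInf₂_le _ (isOutput_iff_forall₂.2 h))

variable {D : ℝ≥0}

/-- Only the first move depends on the starting state, and the triangle inequality bounds the change
by a detour. -/
theorem totalCost_le_add (hG : G.IsLazy) (hD : ∀ s s', G.d s s' ≤ D) (s s' : G.State)
    (ts : List (G.State → ℝ≥0∞)) (zs : List G.State) :
    G.totalCost s ts zs ≤ D + G.totalCost s' ts zs := by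
  match ts, zs with
  | [], _ => simp [totalCost]
  | _ :: _, [] => simp [totalCost]
  | t :: ts, z :: zs =>
    have h : (G.d s z : ℝ≥0∞) ≤ D + G.d s' z := by
      exact_mod_cast (hG.d_triangle s z s').trans (add_le_add_left (hD s s') _)
    simp only [totalCost]
    calc _ ≤ (D + G.d s' z + t z) + G.totalCost z ts zs := by gcongr
      _ = _ := by ring

/-- At the junction the second part restarts from `s'` instead of the last state reached, at a price
of at most `D`. Equal lengths are needed because `totalCost` stops with the shorter list. -/
theorem totalCost_append_le (hG : G.IsLazy) (hD : ∀ s s', G.d s s' ≤ D) (s s' : G.State)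
    {ts ts' : List (G.State → ℝ≥0∞)} {zs zs' : List G.State} (h : ts.length = zs.length) :
    G.totalCost s (ts ++ ts') (zs ++ zs') ≤
      D + (G.totalCost s ts zs + G.totalCost s' ts' zs') := by
  induction ts generalizing s zs with
  | nil =>
    obtain rfl := List.length_eq_zero_iff.1 h.symm
    simpa [totalCost] using totalCost_le_add hG hD s s' ts' zs'
  | cons t ts ih =>
    obtain _ | ⟨z, zs⟩ := zs
    · simp at h
    · simp only [List.cons_append, totalCost]
      calc _ ≤ _ := add_le_add_right (ih z (by simpa using h)) _
        _ = _ := by ring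

theorem le_totalCost_append (hG : G.IsLazy) (hD : ∀ s s', G.d s s' ≤ D) (s s' : G.State)
    {ts ts' : List (G.State → ℝ≥0∞)} {zs zs' : List G.State} (h : ts.length = zs.length) :
    G.totalCost s ts zs + G.totalCost s' ts' zs' ≤
      D + G.totalCost s (ts ++ ts') (zs ++ zs') := by
  induction ts generalizing s zs with
  | nil =>
    obtain rfl := List.length_eq_zero_iff.1 h.symm
    simpa [totalCost] using totalCost_le_add hG hD s' s ts' zs'
  | cons t ts ih =>
    obtain _ | ⟨z, zs⟩ := zs
    · simp at h
    · simp only [List.cons_append, totalCost]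
      calc _ = G.d s z + t z + (G.totalCost z ts zs + G.totalCost s' ts' zs') := by ring
        _ ≤ _ := add_le_add_right (ih z (by simpa using h)) _
        _ = _ := by ring

theorem opt_append_le (hG : G.IsLazy) (hD : ∀ s s', G.d s s' ≤ D) (s s' : G.State)
    (ts ts' : List G.tasks) :
    G.toProblem.opt s (ts ++ ts') ≤ D + (G.toProblem.opt s ts + G.toProblem.opt s' ts') := by
  -- With `D` moved to the left, the right side is a sum of two infima.
  rw [← tsub_le_iff_left]
  refine ENNReal.le_iInf₂_add_iInf₂ fun zs hzs zs' hzs' => tsub_le_iff_left.2 ?_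
  have h := isOutput_iff_forall₂.1 hzs
  refine (iInf₂_le (zs ++ zs') (isOutput_iff_forall₂.2
    (List.rel_append h (isOutput_iff_forall₂.1 hzs')))).trans ?_
  change G.totalCost s ((ts ++ ts').map Subtype.val) (zs ++ zs') ≤ _
  rw [List.map_append]
  exact totalCost_append_le hG hD s s' (by simpa using h.length_eq)

end GenTaskSystem

/-! ### The compact space of strategies -/

namespace GenTaskSystem

section Strategy

variable {G : GenTaskSystem.{u}} {I : Type v} {X : Type w} {init : I → G.State} {req : X → G.tasks}

/-- The deterministic online strategies for inputs with initial states in `I` and requests in `X`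
that are mapped to states and tasks of `G`. -/
abbrev Strategy (G : GenTaskSystem.{u}) (I : Type v) {X : Type w} (req : X → G.tasks) :
    Type (max u v w) :=
  I → List X → (x : X) → {z : G.State // (req x).val z ≠ ∞}

namespace Strategy

def output (σ : Strategy G I req) (i : I) (xs : List X) : List G.State :=
  OnlineProblem.answers (fun l x => (σ i l x).val) xs

theorem isOutput_output (init : I → G.State) (σ : Strategy G I req) (i : I) (xs : List X) :
    G.toProblem.IsOutput (init i) (xs.map req) (σ.output i xs) := by
  refine isOutput_iff_forall₂.2 (List.forall₂_map_left_iff.2 (List.forall₂_iff_get.2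
    ⟨by simp [output], fun k h₁ h₂ => ?_⟩))
  simpa [output, OnlineProblem.answers] using (σ i (xs.take k) xs[k]).2

/-- The cost of a strategy on an input. -/
noncomputable def cost (init : I → G.State) (σ : Strategy G I req) (i : I) (xs : List X) : ℝ :=
  (G.toProblem.cost (init i) (xs.map req) (σ.output i xs)).toReal

theorem ofReal_cost (σ : Strategy G I req) (i : I) (xs : List X) :
    ENNReal.ofReal (σ.cost init i xs) =
      G.toProblem.cost (init i) (xs.map req) (σ.output i xs) :=
  ENNReal.ofReal_toReal (totalCost_ne_top (isOutput_iff_forall₂.1 (σ.isOutput_output init i xs)))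

theorem cost_nonneg (σ : Strategy G I req) (i : I) (xs : List X) : 0 ≤ σ.cost init i xs :=
  ENNReal.toReal_nonneg

/-- The strategy that ignores the initial state and continues after the input `(i, xs)`. -/
def after (σ : Strategy G I req) (i : I) (xs : List X) : Strategy G I req :=
  fun _ l x => σ i (xs ++ l) x

/-- The continuation after a prefix is itself a strategy, so a bound valid for all strategies
applies to each block of a concatenation. -/
theorem cost_append {D : ℝ≥0} (hG : G.IsLazy) (hD : ∀ s s', G.d s s' ≤ D)
    (σ : Strategy G I req) (i j : I) (xs xs' : List X) :
    σ.cost init i xs + (σ.after i xs).cost init j xs' ≤ D + σ.cost init i (xs ++ xs') := by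
  rw [← ENNReal.ofReal_le_ofReal_iff (add_nonneg D.coe_nonneg (cost_nonneg ..)),
    ENNReal.ofReal_add (cost_nonneg ..) (cost_nonneg ..),
    ENNReal.ofReal_add D.coe_nonneg (cost_nonneg ..),
    ofReal_cost, ofReal_cost, ofReal_cost, ENNReal.ofReal_coe_nnreal]
  have h := le_totalCost_append hG hD (init i) (init j)
    (ts := (xs.map req).map Subtype.val) (ts' := (xs'.map req).map Subtype.val)
    (zs := σ.output i xs) (zs' := (σ.after i xs).output j xs') (by simp [output])
  rw [← List.map_append, ← List.map_append] at h
  have h' : σ.output i (xs ++ xs') = σ.output i xs ++ (σ.after i xs).output j xs' :=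
    OnlineProblem.answers_append _ _ _
  rw [h']
  exact h

/-- The output on one input depends on finitely many coordinates, each with finitely many discrete
values. -/
theorem continuous_output_comp [TopologicalSpace G.State] [DiscreteTopology G.State]
    [Finite G.State] {Z : Type*} [TopologicalSpace Z] (g : List G.State → Z) (i : I)
    (xs : List X) : Continuous fun σ : Strategy G I req => g (σ.output i xs) := by
  have h : Continuous fun (σ : Strategy G I req) (k : Fin xs.length) =>
      (σ i (xs.take k.val) xs[k.val]).val := by
    fun_prop
  exact (continuous_of_discreteTopology (f := fun y : Fin xs.length → G.State =>
    g (List.ofFn y))).comp h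

end Strategy

/-- The optimal cost of an input. -/
noncomputable def optCost (init : I → G.State) (req : X → G.tasks) (i : I) (xs : List X) : ℝ :=
  (G.toProblem.opt (init i) (xs.map req)).toReal

theorem ofReal_optCost (i : I) (xs : List X) :
    ENNReal.ofReal (optCost init req i xs) = G.toProblem.opt (init i) (xs.map req) :=
  ENNReal.ofReal_toReal (opt_ne_top _ _)

theorem optCost_nonneg (i : I) (xs : List X) : 0 ≤ optCost init req i xs :=
  ENNReal.toReal_nonneg

theorem optCost_append_le {D : ℝ≥0} (hG : G.IsLazy) (hD : ∀ s s', G.d s s' ≤ D) (i j : I)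
    (xs xs' : List X) :
    optCost init req i (xs ++ xs') ≤ D + (optCost init req i xs + optCost init req j xs') := by
  have hn := add_nonneg (optCost_nonneg (init := init) (req := req) i xs)
    (optCost_nonneg (init := init) (req := req) j xs')
  rw [← ENNReal.ofReal_le_ofReal_iff (add_nonneg D.coe_nonneg hn),
    ENNReal.ofReal_add D.coe_nonneg hn, ENNReal.ofReal_add (optCost_nonneg ..) (optCost_nonneg ..),
    ofReal_optCost, ofReal_optCost, ofReal_optCost, ENNReal.ofReal_coe_nnreal]
  have h := opt_append_le hG hD (init i) (init j) (xs.map req) (xs'.map req)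
  rw [← List.map_append] at h
  exact h

end Strategy

end GenTaskSystem

/-! ### Averaging and exponential moments -/

/-- Some value is at most the weighted mean. -/
theorem exists_le_of_weighted_sum_le {K : Type*} [Fintype K] {p f : K → ℝ} {B : ℝ}
    (hp : ∀ k, 0 ≤ p k) (hp1 : ∑ k, p k = 1) (h : ∑ k, p k * f k ≤ B) : ∃ k, f k ≤ B := by
  by_contra! hcon
  have h1 : ∀ k ∈ Finset.univ, 0 ≤ p k * (f k - B) :=
    fun k _ => mul_nonneg (hp k) (sub_nonneg.2 (hcon k).le)
  have h2 : ∑ k, p k * (f k - B) = ∑ k, p k * f k - B := by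
    simp only [mul_sub, Finset.sum_sub_distrib, ← Finset.sum_mul, hp1, one_mul]
  have h3 := (Finset.sum_eq_zero_iff_of_nonneg h1).1
    (le_antisymm (by linarith) (Finset.sum_nonneg h1))
  have h4 : ∀ k, p k = 0 := fun k => (mul_eq_zero.1 (h3 k (Finset.mem_univ k))).resolve_right
    (sub_pos.2 (hcon k)).ne'
  simp [h4] at hp1

theorem exp_neg_le_of_abs_le_one {x : ℝ} (hx : |x| ≤ 1) : Real.exp (-x) ≤ 1 - x + x ^ 2 := by
  have h := (abs_le.1 (Real.abs_exp_sub_one_sub_id_le (x := -x) (by rwa [abs_neg]))).2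
  rw [neg_sq] at h
  linarith

/-- A bound for the exponential moment of a bounded random variable with a large mean. -/
theorem sum_mul_exp_neg_le {K : Type*} [Fintype K] {p f : K → ℝ} {a b l : ℝ}
    (hp : ∀ k, 0 ≤ p k) (hp1 : ∑ k, p k = 1) (h : a ≤ ∑ k, p k * f k) (hb : ∀ k, |f k| ≤ b)
    (hl : 0 ≤ l) (hlb : l * b ≤ 1) :
    ∑ k, p k * Real.exp (-(l * f k)) ≤ Real.exp (-(l * (a - l * b ^ 2))) := by
  calc ∑ k, p k * Real.exp (-(l * f k))
      ≤ ∑ k, (p k - l * (p k * f k) + p k * (l ^ 2 * b ^ 2)) := by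
        refine Finset.sum_le_sum fun k _ => ?_
        have h1 : |l * f k| ≤ 1 := by
          rw [abs_mul, abs_of_nonneg hl]
          exact (mul_le_mul_of_nonneg_left (hb k) hl).trans hlb
        have h2 := mul_le_mul_of_nonneg_left (exp_neg_le_of_abs_le_one h1) (hp k)
        have h3 : (f k) ^ 2 ≤ b ^ 2 := sq_le_sq.2 ((hb k).trans (le_abs_self b))
        have h4 := mul_le_mul_of_nonneg_left (mul_le_mul_of_nonneg_left h3 (sq_nonneg l)) (hp k)
        calc _ ≤ _ := h2
          _ = p k - l * (p k * f k) + p k * (l ^ 2 * (f k) ^ 2) := by ring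
          _ ≤ _ := by linarith
    _ = 1 - l * ∑ k, p k * f k + l ^ 2 * b ^ 2 := by
        rw [Finset.sum_add_distrib, Finset.sum_sub_distrib, ← Finset.mul_sum, ← Finset.sum_mul,
          hp1, one_mul]
    _ ≤ -(l * (a - l * b ^ 2)) + 1 := by nlinarith
    _ ≤ _ := Real.add_one_le_exp _

/-! ### Hard concatenations and the randomized strategy -/

namespace GenTaskSystem

variable {G : GenTaskSystem.{u}} {I : Type v} {X : Type w} {init : I → G.State} {req : X → G.tasks}

/-- Blocks that are hard on average for every single strategy can be concatenated so that the
resulting input is simultaneously hard for all strategies of a finite family. -/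
theorem exists_hard_concatenation {D : ℝ≥0} (hG : G.IsLazy) (hD : ∀ s s', G.d s s' ≤ D)
    {c l ρ : ℝ} (hl : 0 ≤ l) (hρ0 : 0 ≤ ρ) {K W : Type*} [Fintype K] [Fintype W]
    (blk : K → I × List X) (p : K → ℝ) (hp : ∀ k, 0 ≤ p k) (hp1 : ∑ k, p k = 1)
    (hρ : ∀ σ : Strategy G I req, ∑ k, p k * Real.exp (-(l * (σ.cost init (blk k).1 (blk k).2 -
      c * optCost init req (blk k).1 (blk k).2))) ≤ ρ)
    {N : ℕ} (hN : ∀ k, (blk k).2.length ≤ N) (g : W → Strategy G I req) (i : I) (r : ℕ) :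
    ∃ (xs : List X) (q : ℝ), 0 ≤ q ∧ xs.length ≤ r * N ∧ optCost init req i xs ≤ q + r * D ∧
      ∑ w, Real.exp (-(l * ((g w).cost init i xs + r * D - c * q))) ≤ Fintype.card W * ρ ^ r := by
  induction r with
  | zero =>
    have h : optCost init req i ([] : List X) ≤ 0 := by
      rw [← ENNReal.ofReal_eq_zero, ofReal_optCost]
      exact le_antisymm (iInf₂_le [] (isOutput_iff_forall₂.2 List.Forall₂.nil)) bot_le
    refine ⟨[], 0, le_rfl, by simp, by simpa using h, ?_⟩
    calc _ ≤ ∑ w : W, (1 : ℝ) := Finset.sum_le_sum fun w _ => Real.exp_le_one_iff.2 (by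
            simpa using mul_nonneg hl (Strategy.cost_nonneg (g w) i []))
      _ = _ := by simp
  | succ r ih =>
    -- `q` is the sum of the optima of the blocks chosen so far; the terms `r * D` pay for the
    -- junctions.
    obtain ⟨xs, q, hq, hlen, hopt, hsum⟩ := ih
    set e : W → ℝ := fun w => Real.exp (-(l * ((g w).cost init i xs + r * D - c * q))) with he
    set E : K → W → ℝ := fun k w => Real.exp (-(l * (((g w).after i xs).cost init (blk k).1
      (blk k).2 - c * optCost init req (blk k).1 (blk k).2))) with hE
    -- Method of conditional expectations: averaged over the next block, the potential `∑ w, e w`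
    -- shrinks by the factor `ρ`, so some block does at least as well.
    obtain ⟨k, hk⟩ : ∃ k, ∑ w, e w * E k w ≤ ρ * ∑ w, e w := by
      refine exists_le_of_weighted_sum_le hp hp1 ?_
      calc ∑ k, p k * ∑ w, e w * E k w = ∑ w, e w * ∑ k, p k * E k w := by
            simp only [Finset.mul_sum]
            rw [Finset.sum_comm]
            exact Finset.sum_congr rfl fun w _ => Finset.sum_congr rfl fun k _ => by ring
        _ ≤ ∑ w, e w * ρ := Finset.sum_le_sum fun w _ =>
            mul_le_mul_of_nonneg_left (hρ _) (Real.exp_pos _).le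
        _ = _ := by rw [← Finset.sum_mul, mul_comm]
    refine ⟨xs ++ (blk k).2, q + optCost init req (blk k).1 (blk k).2,
      add_nonneg hq (optCost_nonneg ..), ?_, ?_, ?_⟩
    · rw [List.length_append, Nat.succ_mul]
      exact add_le_add hlen (hN k)
    · have := optCost_append_le (init := init) (req := req) hG hD i (blk k).1 xs (blk k).2
      push_cast
      linarith
    · calc _ ≤ ∑ w, e w * E k w := by
            refine Finset.sum_le_sum fun w _ => ?_
            rw [he, hE, ← Real.exp_add, Real.exp_le_exp]
            have h1 := mul_le_mul_of_nonneg_left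
              ((g w).cost_append (init := init) hG hD i (blk k).1 xs (blk k).2) hl
            push_cast
            linarith
        _ ≤ ρ * ∑ w, e w := hk
        _ ≤ Fintype.card W * ρ ^ (r + 1) := by
            calc _ ≤ _ := mul_le_mul_of_nonneg_left hsum hρ0
              _ = _ := by ring

/-- If finite families of strategies of subexponential size contain `c`-competitive strategies for
the inputs of bounded length, then no distribution over inputs is hard for every strategy. -/
theorem exists_strategy_of_small_families {D : ℝ≥0} (hG : G.IsLazy) (hD : ∀ s s', G.d s s' ≤ D)
    {c α : ℝ} (hc : 0 ≤ c) {b : ℕ → ℕ}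
    (hb : (fun n => (b n : ℝ)) =o[atTop] fun n => (n : ℝ))
    (hg : ∀ n, ∃ g : (Fin (b n) → Bool) → Strategy G I req, ∀ (i : I) (xs : List X),
      xs.length ≤ n → ∃ w, (g w).cost init i xs ≤ c * optCost init req i xs + α)
    {K : Type*} [Fintype K] (blk : K → I × List X) {B : ℝ}
    (hB : ∀ (σ : Strategy G I req) k, |σ.cost init (blk k).1 (blk k).2 -
      c * optCost init req (blk k).1 (blk k).2| ≤ B)
    (p : K → ℝ) (hp : ∀ k, 0 ≤ p k) (hp1 : ∑ k, p k = 1) :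
    ∃ σ : Strategy G I req, ∑ k, p k * (σ.cost init (blk k).1 (blk k).2 -
      c * optCost init req (blk k).1 (blk k).2) < D + c * D + 1 := by
  by_contra! hcon
  obtain ⟨k₀⟩ : Nonempty K := by
    by_contra h
    rw [not_nonempty_iff] at h
    simp at hp1
  have hB0 : 0 ≤ B :=
    (abs_nonneg _).trans (hB (fun _ _ x => ⟨_, (G.exists_ne_top _ (req x).2).choose_spec⟩) k₀)
  -- Chosen so that `l * B ≤ 1`, as the moment bound requires, and `l * B ^ 2 ≤ 1 / 2`, which spares
  -- half of the unit margin.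
  set l : ℝ := 1 / (2 * (B + 1) ^ 2) with hl
  have hl0 : 0 < l := by positivity
  have hlB2 : l * B ^ 2 ≤ 1 / 2 := by
    rw [hl, div_mul_eq_mul_div, one_mul, div_le_div_iff₀ (by positivity) (by norm_num)]
    nlinarith
  have hlB : l * B ≤ 1 := by
    rw [hl, div_mul_eq_mul_div, one_mul, div_le_one (by positivity)]
    nlinarith
  obtain ⟨N, hN0, hN⟩ : ∃ N : ℕ, 0 < N ∧ ∀ k, (blk k).2.length ≤ N :=
    ⟨∑ k, (blk k).2.length + 1, Nat.succ_pos _, fun k =>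
      (Finset.single_le_sum (f := fun k => (blk k).2.length) (fun _ _ => Nat.zero_le _)
        (Finset.mem_univ k)).trans (Nat.le_succ _)⟩
  -- Of the mean `D + c * D + 1` per block, `D` pays for the cost at a junction, `c * D` for the
  -- optimum there, and at most `1 / 2` for the second-order term. The logarithm comes from the `2 ^
  -- b` advice strings.
  have key : ∀ r : ℕ, (r : ℝ) / 2 ≤ α + b (r * N) * (Real.log 2 / l) := by
    intro r
    obtain ⟨g, hg⟩ := hg (r * N)
    obtain ⟨xs, q, hq, hlen, hopt, hsum⟩ := exists_hard_concatenation hG hD hl0.le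
      (Real.exp_pos _).le blk p hp hp1
      (fun σ => sum_mul_exp_neg_le hp hp1 (hcon σ) (hB σ) hl0.le hlB) hN g (blk k₀).1 r
    obtain ⟨w, hw⟩ := hg (blk k₀).1 xs hlen
    have h1 := (Finset.single_le_sum (f := fun w => Real.exp (-(l * ((g w).cost init (blk k₀).1 xs +
      r * D - c * q)))) (fun w _ => (Real.exp_pos _).le) (Finset.mem_univ w)).trans hsum
    have h2 : ((Fintype.card (Fin (b (r * N)) → Bool) : ℕ) : ℝ) =
        Real.exp (b (r * N) * Real.log 2) := by
      rw [Real.exp_nat_mul, Real.exp_log two_pos]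
      simp
    rw [h2, ← Real.exp_nat_mul, ← Real.exp_add, Real.exp_le_exp] at h1
    have h3 : (r : ℝ) * (D + c * D + 1 - l * B ^ 2) ≤
        (g w).cost init (blk k₀).1 xs + r * D - c * q + b (r * N) * (Real.log 2 / l) := by
      refine le_of_mul_le_mul_left ?_ hl0
      have h4 : l * (b (r * N) * (Real.log 2 / l)) = b (r * N) * Real.log 2 := by
        field_simp
      rw [mul_add, h4]
      linarith
    have h5 := mul_le_mul_of_nonneg_left hopt hc
    have h6 := mul_le_mul_of_nonneg_left hlB2 (Nat.cast_nonneg (α := ℝ) r)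
    linarith
  set M : ℝ := Real.log 2 / l with hM
  have hM0 : 0 < M := div_pos (Real.log_pos one_lt_two) hl0
  have hN0' : (0 : ℝ) < N := Nat.cast_pos.2 hN0
  -- This constant makes the advice term at most `r / 4`; then `r / 4 ≤ α`, which fails for `r > 4 *
  -- α`.
  have hev := (hb.def (c := 1 / (4 * M * N)) (by positivity)).and
    (eventually_gt_atTop 0)
  obtain ⟨n₀, hn₀⟩ := eventually_atTop.1 hev
  obtain ⟨m, hm⟩ := exists_nat_gt (4 * α)
  set r := max m n₀ + 1 with hr
  have h1 := (hn₀ (r * N) (by nlinarith [le_max_right m n₀])).1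
  rw [Real.norm_of_nonneg (Nat.cast_nonneg _), Real.norm_of_nonneg (Nat.cast_nonneg _)] at h1
  have h2 := key r
  have h3 : (b (r * N) : ℝ) * M ≤ r / 4 := by
    calc _ ≤ 1 / (4 * M * N) * ((r * N : ℕ) : ℝ) * M := by gcongr
      _ = _ := by push_cast; field_simp
  have h4 : (m : ℝ) < r := by
    exact_mod_cast Nat.lt_succ_of_le (le_max_left m n₀)
  linarith

/-- Small families of strategies can be replaced by a single randomized strategy. -/
theorem exists_randomized_strategy (hG : G.IsLazy) [Finite G.State] [TopologicalSpace G.State]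
    [DiscreteTopology G.State] {c α : ℝ} (hc : 0 ≤ c) {b : ℕ → ℕ}
    (hb : (fun n => (b n : ℝ)) =o[atTop] fun n => (n : ℝ))
    (hg : ∀ n, ∃ g : (Fin (b n) → Bool) → Strategy G I req, ∀ (i : I) (xs : List X),
      xs.length ≤ n → ∃ w, (g w).cost init i xs ≤ c * optCost init req i xs + α)
    [MeasurableSpace (Strategy G I req)] [BorelSpace (Strategy G I req)] :
    ∃ (μ : ProbabilityMeasure (Strategy G I req)) (β : ℝ≥0), ∀ i xs,
      Integrable (fun σ => σ.cost init i xs) (μ : Measure (Strategy G I req)) ∧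
      ∫ σ, σ.cost init i xs ∂(μ : Measure (Strategy G I req)) ≤ c * optCost init req i xs + β := by
  obtain ⟨D, hD⟩ : ∃ D : ℝ≥0, ∀ s s', G.d s s' ≤ D := by
    obtain ⟨D, hD⟩ := (Set.finite_range fun q : G.State × G.State => G.d q.1 q.2).bddAbove
    exact ⟨D, fun s s' => hD ⟨(s, s'), rfl⟩⟩
  have hcont : ∀ i xs, Continuous fun σ : Strategy G I req => σ.cost init i xs := fun i xs =>
    Strategy.continuous_output_comp
      (fun zs => (G.toProblem.cost (init i) (xs.map req) zs).toReal) i xs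
  have hne : Nonempty (Strategy G I req) :=
    ⟨fun _ _ x => ⟨_, (G.exists_ne_top _ (req x).2).choose_spec⟩⟩
  obtain ⟨μ, hμ⟩ := exists_probabilityMeasure_integral_le (J := I × List X)
    (fun j => (⟨fun σ => σ.cost init j.1 j.2 - c * optCost init req j.1 j.2,
      (hcont _ _).sub continuous_const⟩ : C(Strategy G I req, ℝ))) (D + c * D + 1) (by
      intro F p hp hp1
      -- The excess on a fixed input is continuous on a compact space, hence bounded uniformly over
      -- strategies.
      have hbd : ∀ k : F, ∃ B : ℝ, ∀ σ : Strategy G I req,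
          |σ.cost init k.1.1 k.1.2 - c * optCost init req k.1.1 k.1.2| ≤ B := by
        intro k
        obtain ⟨B, hB⟩ := (isCompact_range (((hcont k.1.1 k.1.2).sub
          (continuous_const (y := c * optCost init req k.1.1 k.1.2))).abs)).bddAbove
        exact ⟨B, fun σ => hB ⟨σ, rfl⟩⟩
      choose B hB using hbd
      obtain ⟨B', hB'⟩ := (Set.finite_range B).bddAbove
      exact exists_strategy_of_small_families hG hD hc hb hg (fun k : F => k.1)
        (fun σ k => (hB k σ).trans (hB' ⟨k, rfl⟩)) p hp hp1)
  refine ⟨μ, (D + c * D + 1).toNNReal, fun i xs => ?_⟩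
  have hint : Integrable (fun σ => σ.cost init i xs) (μ : Measure (Strategy G I req)) :=
    integrable_continuousMap ⟨_, hcont i xs⟩ _
  refine ⟨hint, ?_⟩
  have h := hμ (i, xs)
  simp only [ContinuousMap.coe_mk] at h
  rw [integral_sub hint (integrable_const _)] at h
  simp only [integral_const, probReal_univ, one_smul] at h
  rw [Real.coe_toNNReal _ (by positivity)]
  linarith

end GenTaskSystem

/-! ### Online translation and optima under a modeling -/

namespace OnlineProblem

theorem answers_take {X : Type v} {Y : Type w} (f : List X → X → Y) (xs : List X) (k : ℕ) :
    answers f (xs.take k) = (answers f xs).take k := by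
  conv_rhs => rw [← List.take_append_drop k xs, answers_append]
  by_cases h : k ≤ xs.length
  · rw [List.take_left' (by simpa using h)]
  · push Not at h
    rw [List.drop_of_length_le h.le, List.take_of_length_le h.le]
    simp [List.take_of_length_le, h.le]

theorem answers_congr {X : Type v} {Y : Type w} {f g : List X → X → Y} {xs : List X}
    (h : ∀ (k : ℕ) (hk : k < xs.length), f (xs.take k) xs[k] = g (xs.take k) xs[k]) :
    answers f xs = answers g xs := by
  unfold answers
  congr 1
  funext k
  exact h k k.2

/-- Translating the answers of a rule online is again following a rule. -/
theorem answers_translate {X : Type v} {Y : Type w} {Z : Type w'} (f : List X → X → Y)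
    (e : List X → List Y → Z) (xs : List X) :
    answers (fun l x => e (l ++ [x]) (answers f (l ++ [x]))) xs =
      onlineTranslate e xs (answers f xs) := by
  unfold onlineTranslate
  rw [answers]
  congr 1
  funext k
  rw [← List.take_succ_eq_append_getElem k.2, answers_take]

namespace Modeling

variable {P : OnlineProblem.{u, v, w}} {Q : OnlineProblem.{u', v', w'}}

theorem opt_le (m : P.Modeling Q) (s : P.Init) (xs : List P.Req) :
    P.opt s xs ≤ Q.opt (m.init s) (xs.map m.req) :=
  le_iInf₂ fun zs hzs => iInf₂_le_of_le _ (m.isOutput_dec s xs zs hzs) (m.cost_dec_le s xs zs hzs)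

theorem le_opt (m : P.Modeling Q) (s : P.Init) (xs : List P.Req) :
    Q.opt (m.init s) (xs.map m.req) ≤ P.opt s xs :=
  le_iInf₂ fun ys hys => iInf₂_le_of_le _ (m.isOutput_enc s xs ys hys) (m.cost_enc_le s xs ys hys)

end Modeling

end OnlineProblem

/-! ### Dependence on the tape -/

namespace AdviceAlg

variable {P : OnlineProblem.{u, v, w}} (A : AdviceAlg P)

theorem bitsRead_le_append (φ : Tape) (s : P.Init) (xs xs' : List P.Req) :
    A.bitsRead φ s xs ≤ A.bitsRead φ s (xs ++ xs') := by
  induction xs' using List.reverseRecOn with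
  | nil => simp
  | append_singleton l x ih =>
    rw [← List.append_assoc]
    exact ih.trans (A.bitsRead_mono φ s _ x)

/-- The answers depend only on the part of the tape that is read. -/
theorem answers_congr_tape {φ φ' : Tape} {s : P.Init} {xs : List P.Req}
    (h : ∀ i < A.bitsRead φ s xs, φ i = φ' i) :
    OnlineProblem.answers (A.answer φ s) xs = OnlineProblem.answers (A.answer φ' s) xs := by
  refine OnlineProblem.answers_congr fun k hk => A.answer_congr φ φ' s _ _ fun i hi =>
    h i (hi.trans_le ?_)
  rw [← List.take_succ_eq_append_getElem hk]
  conv_rhs => rw [← List.take_append_drop (k + 1) xs]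
  exact A.bitsRead_le_append _ _ _ _

theorem bitsRead_advice_le {b n : ℕ} (hb : A.adviceComplexity n = b) (s : P.Init)
    {xs : List P.Req} (hxs : xs.length ≤ n) : A.bitsRead (A.advice s xs) s xs ≤ b := by
  have h : (A.bitsRead (A.advice s xs) s xs : ℕ∞) ≤ A.adviceComplexity n :=
    le_iSup_of_le s (le_iSup₂_of_le xs hxs le_rfl)
  rw [hb] at h
  exact_mod_cast h

end AdviceAlg

/-- The tape that starts with the given bits. -/
def Tape.ofBits {n : ℕ} (w : Fin n → Bool) : Tape := fun i => if h : i < n then w ⟨i, h⟩ else false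

/-! ### Transfer of algorithms through a modeling -/

namespace OnlineProblem.Modeling

variable {P : OnlineProblem.{u, v, w}} {G : GenTaskSystem.{u'}}

theorem ofReal_mul_optCost_add (m : P.Modeling G.toProblem) (c α : ℝ≥0) (i : P.Init)
    (xs : List P.Req) :
    ENNReal.ofReal (c * GenTaskSystem.optCost (G := G) m.init m.req i xs + α) =
      c * G.toProblem.opt (m.init i) (xs.map m.req) + α := by
  have h := GenTaskSystem.optCost_nonneg (G := G) (init := m.init) (req := m.req) i xs
  rw [ENNReal.ofReal_add (mul_nonneg c.coe_nonneg h) α.coe_nonneg,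
    ENNReal.ofReal_mul c.coe_nonneg, ENNReal.ofReal_coe_nnreal, ENNReal.ofReal_coe_nnreal]
  exact congrArg (fun y => c * y + (α : ℝ≥0∞)) (GenTaskSystem.ofReal_optCost i xs)

/-- A rule for `G`, made into a strategy by overriding its invalid answers. -/
noncomputable def toStrategy (m : P.Modeling G.toProblem)
    (f : P.Init → List P.Req → P.Req → G.State) : GenTaskSystem.Strategy G P.Init m.req :=
  fun i l x => by
    classical
    exact if h : (m.req x).val (f i l x) ≠ ∞ then ⟨f i l x, h⟩
      else ⟨_, (G.exists_ne_top _ (m.req x).2).choose_spec⟩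

/-- On inputs where the rule answers validly, the override is never triggered. An advice algorithm
needs this, since it is guaranteed valid only on the tape made for the input. -/
theorem output_toStrategy (m : P.Modeling G.toProblem)
    {f : P.Init → List P.Req → P.Req → G.State} {i : P.Init} {xs : List P.Req}
    (h : G.toProblem.IsOutput (m.init i) (xs.map m.req) (answers (f i) xs)) :
    (m.toStrategy f).output i xs = answers (f i) xs := by
  refine answers_congr fun k hk => ?_
  have hv := (List.forall₂_iff_get.1 (List.forall₂_map_left_iff.1
    (GenTaskSystem.isOutput_iff_forall₂.1 h))).2 k hk (hk.trans_eq (length_answers _ _).symm)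
  have e : (answers (f i) xs)[k]'(hk.trans_eq (length_answers _ _).symm) =
      f i (xs.take k) xs[k] := by
    simp [answers]
  exact congrArg Subtype.val (dif_pos fun h₀ => hv ((congrArg (m.req xs[k]).val e).trans h₀))

/-- The strategy that follows an algorithm with advice on a fixed tape. -/
noncomputable def adviceStrategy (m : P.Modeling G.toProblem) (A : AdviceAlg P) (φ : Tape) :
    GenTaskSystem.Strategy G P.Init m.req :=
  m.toStrategy fun i l x => m.enc i (l ++ [x]) (answers (A.answer φ i) (l ++ [x]))

theorem exists_adviceStrategy_cost_le (m : P.Modeling G.toProblem) (A : AdviceAlg P) {c α : ℝ≥0}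
    (hA : ∀ s xs, A.cost s xs ≤ c * P.opt s xs + α) {b n : ℕ} (hb : A.adviceComplexity n = b)
    (i : P.Init) {xs : List P.Req} (hxs : xs.length ≤ n) :
    ∃ w : Fin b → Bool, (m.adviceStrategy A (Tape.ofBits w)).cost m.init i xs ≤
      c * GenTaskSystem.optCost m.init m.req i xs + α := by
  -- The first `b` bits of the oracle's tape; the padding by `false` is never read on this input.
  refine ⟨fun k => A.advice i xs k, ?_⟩
  set φ : Tape := Tape.ofBits fun k : Fin b => A.advice i xs k with hφ
  have hans : A.output i xs = answers (A.answer φ i) xs :=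
    A.answers_congr_tape fun k hk => by
      simp [hφ, Tape.ofBits, hk.trans_le (A.bitsRead_advice_le hb i hxs)]
  have hout := A.isOutput i xs
  have htr : answers (fun l x => m.enc i (l ++ [x]) (answers (A.answer φ i) (l ++ [x]))) xs =
      onlineTranslate (m.enc i) xs (A.output i xs) := by
    rw [answers_translate, hans]
  have h : (m.adviceStrategy A φ).output i xs = onlineTranslate (m.enc i) xs (A.output i xs) := by
    rw [← htr]
    refine m.output_toStrategy ?_
    rw [htr]
    exact m.isOutput_enc _ _ _ hout
  have hopt : 0 ≤ (c : ℝ) * GenTaskSystem.optCost m.init m.req i xs :=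
    mul_nonneg c.coe_nonneg (GenTaskSystem.optCost_nonneg ..)
  refine (ENNReal.ofReal_le_ofReal_iff (add_nonneg hopt α.coe_nonneg)).1 ?_
  calc _ = G.toProblem.cost (m.init i) (xs.map m.req) ((m.adviceStrategy A φ).output i xs) :=
        GenTaskSystem.Strategy.ofReal_cost _ _ _
    _ ≤ P.cost i xs (A.output i xs) := by rw [h]; exact m.cost_enc_le _ _ _ hout
    _ ≤ c * P.opt i xs + α := hA i xs
    _ ≤ c * G.toProblem.opt (m.init i) (xs.map m.req) + α := by gcongr; exact m.opt_le i xs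
    _ = _ := (m.ofReal_mul_optCost_add c α i xs).symm

/-- The algorithm for `P` that translates the states chosen by a strategy. -/
def toDetAlg (m : P.Modeling G.toProblem) (σ : GenTaskSystem.Strategy G P.Init m.req) :
    DetAlg P where
  answer s l x := m.dec s (l ++ [x]) (σ.output s (l ++ [x]))
  isOutput s xs := by
    have h := answers_translate (fun l x => (σ s l x).val) (m.dec s) xs
    unfold GenTaskSystem.Strategy.output
    rw [h]
    exact m.isOutput_dec s xs _ (σ.isOutput_output m.init s xs)

theorem output_toDetAlg (m : P.Modeling G.toProblem) (σ : GenTaskSystem.Strategy G P.Init m.req)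
    (s : P.Init) (xs : List P.Req) :
    (m.toDetAlg σ).output s xs = onlineTranslate (m.dec s) xs (σ.output s xs) :=
  answers_translate (fun l x => (σ s l x).val) (m.dec s) xs

theorem cost_toDetAlg_le (m : P.Modeling G.toProblem) (σ : GenTaskSystem.Strategy G P.Init m.req)
    (s : P.Init) (xs : List P.Req) :
    (m.toDetAlg σ).cost s xs ≤ ENNReal.ofReal (σ.cost m.init s xs) := by
  rw [DetAlg.cost, output_toDetAlg]
  exact (m.cost_dec_le s xs _ (σ.isOutput_output m.init s xs)).trans_eq
    (GenTaskSystem.Strategy.ofReal_cost σ s xs).symm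

section RandAlg

variable (m : P.Modeling G.toProblem) [Finite G.State] [TopologicalSpace G.State]
  [DiscreteTopology G.State] [MeasurableSpace (GenTaskSystem.Strategy G P.Init m.req)]
  [BorelSpace (GenTaskSystem.Strategy G P.Init m.req)]

theorem measurable_cost_toDetAlg (s : P.Init) (xs : List P.Req) :
    Measurable fun σ : GenTaskSystem.Strategy G P.Init m.req => (m.toDetAlg σ).cost s xs := by
  simp only [DetAlg.cost, output_toDetAlg]
  exact (GenTaskSystem.Strategy.continuous_output_comp
    (fun zs => P.cost s xs (onlineTranslate (m.dec s) xs zs)) s xs).measurable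

/-- The randomized algorithm for `P` that translates a random strategy. -/
noncomputable def toRandAlg (μ : ProbabilityMeasure (GenTaskSystem.Strategy G P.Init m.req)) :
    RandAlg P where
  -- The largest σ-algebra making `toDetAlg` measurable: events are tested on strategies.
  events := MeasurableSpace.map m.toDetAlg inferInstance
  law := @Measure.map _ _ _ (MeasurableSpace.map m.toDetAlg inferInstance) m.toDetAlg μ
  isProbabilityMeasure :=
    @Measure.isProbabilityMeasure_map _ _ _ (MeasurableSpace.map m.toDetAlg inferInstance) _ _ _
      (@Measurable.aemeasurable _ _ _ (MeasurableSpace.map m.toDetAlg inferInstance) _ _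
        (measurable_iff_le_map.2 le_rfl))
  measurableSet_output s xs ys := by
    change MeasurableSet {σ | (m.toDetAlg σ).output s xs = ys}
    simp only [output_toDetAlg]
    -- Discreteness turns the event into the open preimage of `{True}` under a continuous map.
    let _ : TopologicalSpace Prop := ⊥
    have _ : DiscreteTopology Prop := ⟨rfl⟩
    exact ((GenTaskSystem.Strategy.continuous_output_comp
      (fun zs => onlineTranslate (m.dec s) xs zs = ys) s xs).isOpen_preimage {True}
        (isOpen_discrete _)).measurableSet.congr (by ext; simp)
  measurable_cost s xs := fun _ ht => m.measurable_cost_toDetAlg s xs ht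

theorem expectedCost_toRandAlg (μ : ProbabilityMeasure (GenTaskSystem.Strategy G P.Init m.req))
    (s : P.Init) (xs : List P.Req) :
    (m.toRandAlg μ).expectedCost s xs =
      ∫⁻ σ, (m.toDetAlg σ).cost s xs ∂(μ : Measure (GenTaskSystem.Strategy G P.Init m.req)) :=
  @lintegral_map _ _ _ (MeasurableSpace.map m.toDetAlg inferInstance) _ _ _
    ((m.toRandAlg μ).measurable_cost s xs) (measurable_iff_le_map.2 le_rfl)

end RandAlg

end OnlineProblem.Modeling

theorem mainTheorem9 (P : OnlineProblem.{u, v, w})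
    (hP : OnlineProblem.CanBeModeledAsFiniteLTS.{u, v, w, u'} P)
    (c : ℝ≥0) (hc : 1 ≤ c)
    (A : AdviceAlg P) (hA : P.IsCompetitive c A.cost) (hAdvice : A.HasSublinearAdvice)
    (ε : ℝ≥0) (hε : 0 < ε) :
    ∃ R : RandAlg P, P.IsCompetitive (c + ε) R.expectedCost := by
  obtain ⟨G, hG, ⟨hfin, -⟩, ⟨m⟩⟩ := hP
  obtain ⟨α, hα⟩ := hA
  obtain ⟨b, hb, hbo⟩ := hAdvice
  -- Discrete topology on the finite state set: the strategy space becomes a product of compact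
  -- factors.
  let _ : TopologicalSpace G.State := ⊥
  have _ : DiscreteTopology G.State := ⟨rfl⟩
  let _ : MeasurableSpace (GenTaskSystem.Strategy G P.Init m.req) := borel _
  have _ : BorelSpace (GenTaskSystem.Strategy G P.Init m.req) := ⟨rfl⟩
  obtain ⟨μ, β, hμ⟩ := GenTaskSystem.exists_randomized_strategy (init := m.init) (req := m.req)
    (α := α) hG c.coe_nonneg hbo fun n => ⟨fun w => m.adviceStrategy A (Tape.ofBits w),
      fun i xs hxs => m.exists_adviceStrategy_cost_le A hα (hb n) i hxs⟩
  refine ⟨m.toRandAlg μ, β, fun s xs => ?_⟩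
  obtain ⟨hint, hle⟩ := hμ s xs
  rw [m.expectedCost_toRandAlg]
  calc _ ≤ ∫⁻ σ : GenTaskSystem.Strategy G P.Init m.req,
        ENNReal.ofReal (σ.cost m.init s xs) ∂(μ : Measure _) :=
        lintegral_mono fun σ => m.cost_toDetAlg_le σ s xs
    _ = ENNReal.ofReal (∫ σ : GenTaskSystem.Strategy G P.Init m.req,
        σ.cost m.init s xs ∂(μ : Measure _)) :=
        (ofReal_integral_eq_lintegral_ofReal hint
          (ae_of_all _ fun σ => GenTaskSystem.Strategy.cost_nonneg σ s xs)).symm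
    _ ≤ ENNReal.ofReal (c * GenTaskSystem.optCost m.init m.req s xs + β) :=
        ENNReal.ofReal_le_ofReal hle
    _ = c * G.toProblem.opt (m.init s) (xs.map m.req) + β := m.ofReal_mul_optCost_add c β s xs
    -- The ratio reached so far is `c` itself.
    _ ≤ (c + ε : ℝ≥0) * P.opt s xs + β := by
        gcongr
        · exact le_self_add
        · exact m.le_opt s xs
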